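/- For $\tau>0$ let $\mathcal B_1(\tau)$ be the space of all complex-valued $G\in L^1(\mathbb R)$ whose (distributional) Fourier transform, normalized as $\widehat\varphi(t)=\int_{\mathbb R}\varphi(x)e^{-2\pi i x t}\,dx$, is supported in $[-\tau,\tau]$. There are constants $C_{\tau,\delta}$, one for each pair $\tau,\delta>0$ and depending only on $\tau$ and $\delta$, such that for all $\tau,\delta>0$, every Lebesgue measurable $N\subseteq\mathbb R$ and every $G\in\mathcal B_1(\tau)$ $$\|G\chi_N\|_1\le C_{\tau,\delta}\,\sup_{x\in\mathbb R}\bigl|N\cap[x,x+\delta]\bigr|\,\|G\|_1,$$ where $|\cdot|$ is Lebesgue measure and $\chi_N$ is the characteristic function of $N$, and such that - $C_{\tau,\delta}\le \frac{80}{13}\,(\tau+\delta^{-1})$ for all $\tau,\delta>0$; - $C_{\tau,\delta}\le \frac52\,(\tau+\delta^{-1})$ whenever $\tau\delta\ge 2$; - $\displaystyle \frac{C_{\tau,\delta}}{\tau+\delta^{-1}}\to 2$ as $\tau\delta\to\infty$, i.e. for every $\varepsilon>0$ there is $R$ such that $\left|\frac{C_{\tau,\delta}}{\tau+\delta^{-1}}-2\right|<\varepsilon$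 for all $\tau,\delta>0$ with $\tau\delta\ge R$. -/

import Mathlib

open MeasureTheory Filter Topology
open scoped ENNReal SchwartzMap FourierTransform

noncomputable section

/-- The Paley–Wiener space `B_p(M)`: the elements of `L^p(E)` (complex valued, Lebesgue measure)
whose distributional Fourier transform is supported in `M`. The Fourier transform of a tempered
distribution `f` is `φ ↦ f (𝓕 φ)`, where `𝓕 φ t = ∫ φ x * exp (-2 π i ⟪x, t⟫) dx`. -/
def paleyWiener {E : Type*} [NormedAddCommGroup E] [InnerProductSpace ℝ E] [FiniteDimensional ℝ E]
    [MeasurableSpace E] [BorelSpace E] (p : ℝ≥0∞) [Fact (1 ≤ p)] (M : Set E) :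
    Set (Lp ℂ p (volume : Measure E)) :=
  {f | Distribution.dsupport (𝓕 (Lp.toTemperedDistribution f) : 𝓢'(E, ℂ)) ⊆ M}

/-- `B_p(τ)` in dimension one: the frequencies lie in the ball `[-τ, τ]`. -/
def paleyWienerBall (p : ℝ≥0∞) [Fact (1 ≤ p)] (τ : ℝ) : Set (Lp ℂ p (volume : Measure ℝ)) :=
  paleyWiener p (Metric.closedBall (0 : ℝ) τ)

/-- `C` is admissible for `τ` and `δ` if
`‖G χ_N‖₁ ≤ C * sup_x |N ∩ [x, x + δ]| * ‖G‖₁` for all `G ∈ B₁(τ)` and all (Lebesgue)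
measurable `N ⊆ ℝ`. -/
def IsConcentrationConstant (τ δ C : ℝ) : Prop :=
  ∀ N : Set ℝ, NullMeasurableSet N volume → ∀ G ∈ paleyWienerBall 1 τ,
    eLpNorm (N.indicator G) 1 volume ≤
      ENNReal.ofReal C * (⨆ x : ℝ, volume (N ∩ Set.Icc x (x + δ))) * eLpNorm G 1 volume

end

/-! Let `K` be the de la Vallée-Poussin kernel with `c = τ + b`. Its Fourier transform is `1` on
`[-τ, τ]`, so `G = G ⋆ K` almost everywhere for `G ∈ B₁(τ)`. Cut `K` at distance `δ / 2` from the
origin. The near part is bounded by `2c` and lives on an interval of length `δ`, so it contributes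
at most `2c · sup |N ∩ [x, x + δ]| · ‖G‖₁`. If the far part has `L¹` norm at most `η < 1`, then its
convolution with `G` is again band-limited and has norm at most `η ‖G‖₁`. Iterating sums a geometric
series and gives the constant `2(τ + b) / (1 - η)` (`IsBandlimited.setLIntegral_le`).

The rest is the choice of `b`: `b = 1/δ` allows `η = 1/5` and yields `5/2`, while `b = √(τδ) / (2δ)`
makes both losses `O(1/√(τδ))` and yields the limit `2`. -/

noncomputable section

/-! ### Band-limited functions and Fourier inversion -/

/-- An integrable function whose Fourier transform vanishes outside `[-τ, τ]`. -/
def IsBandlimited (τ : ℝ) (G : ℝ → ℂ) : Prop :=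
  Integrable G ∧ ∀ t : ℝ, τ < |t| → 𝓕 G t = 0

theorem continuous_fourier_of_integrable {G : ℝ → ℂ} (hG : Integrable G) : Continuous (𝓕 G) :=
  VectorFourier.fourierIntegral_continuous Real.continuous_fourierChar
    (L := innerₗ ℝ) continuous_inner hG

theorem integral_fourier_mul_eq_integral_mul_fourier {f g : ℝ → ℂ} (hf : Integrable f)
    (hg : Integrable g) : ∫ t, 𝓕 f t * g t = ∫ x, f x * 𝓕 g x :=
  calc ∫ t, 𝓕 f t * g t = ∫ x, f x * VectorFourier.fourierIntegral Real.fourierChar volume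
        (innerₗ ℝ).flip g x :=
        VectorFourier.integral_fourierIntegral_smul_eq_flip (L := innerₗ ℝ)
          Real.continuous_fourierChar continuous_inner hf hg
    _ = ∫ x, f x * 𝓕 g x := by rw [flip_innerₗ]; rfl

/-- The transform of an integrable function is continuous, so vanishing as a distribution near `t`
forces vanishing at `t`. -/
theorem isBandlimited_of_mem_paleyWienerBall {τ : ℝ} {G : Lp ℂ 1 (volume : Measure ℝ)}
    (hG : G ∈ paleyWienerBall 1 τ) : IsBandlimited τ G := by
  have hint : Integrable G := L1.integrable_coeFn G
  refine ⟨hint, fun t ht => ?_⟩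
  have hcont := continuous_fourier_of_integrable hint
  have ht' : t ∉ Distribution.dsupport (𝓕 (Lp.toTemperedDistribution G) : 𝓢'(ℝ, ℂ)) := by
    intro h
    have := hG h
    rw [Metric.mem_closedBall, dist_zero_right, Real.norm_eq_abs] at this
    linarith
  obtain ⟨s, hs, hso, hts⟩ := (Distribution.notMem_dsupport_iff t).1 ht'
  have hae : ∀ᵐ x, x ∈ s → 𝓕 (G : ℝ → ℂ) x = 0 := by
    refine hso.ae_eq_zero_of_integral_contDiff_smul_eq_zero
      (hcont.locallyIntegrable.locallyIntegrableOn s) fun g g_smooth g_cpt g_supp => ?_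
    have hg₁ : HasCompactSupport (Complex.ofRealCLM ∘ g) := g_cpt.comp_left rfl
    have hg₂ : ContDiff ℝ (⊤ : ℕ∞) (Complex.ofRealCLM ∘ g) := by fun_prop
    have h0 := hs (hg₁.toSchwartzMap hg₂) 
      ((tsupport_comp_subset (g := Complex.ofRealCLM) (map_zero _) g).trans g_supp)
    rw [TemperedDistribution.fourier_apply, Lp.toTemperedDistribution_apply] at h0
    have h1 := integral_fourier_mul_eq_integral_mul_fourier hint
      (hg₁.toSchwartzMap hg₂).integrable
    calc ∫ x, g x • 𝓕 (G : ℝ → ℂ) x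
        = ∫ x, 𝓕 (G : ℝ → ℂ) x * (hg₁.toSchwartzMap hg₂) x := by
          congr with x
          simp [mul_comm]
      _ = _ := h1
      _ = 0 := by
          rw [← h0]
          congr with x
          simp [mul_comm, SchwartzMap.fourier_coe]
  have hfreq : ∃ᶠ x in 𝓝 t, 𝓕 (G : ℝ → ℂ) x = 0 := by
    rw [frequently_iff]
    intro U hU
    obtain ⟨x, hx, hxU⟩ : ∃ x, (x ∈ s → 𝓕 (G : ℝ → ℂ) x = 0) ∧ x ∈ U ∩ s := by
      by_contra! hcon
      have hnull : volume (U ∩ s) = 0 := measure_mono_null (fun x hx h => hcon x h hx) hae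
      exact (Measure.measure_pos_of_mem_nhds volume (inter_mem hU (hso.mem_nhds hts))).ne' hnull
    exact ⟨x, hxU.1, hx hxU.2⟩
  have hclosed : IsClosed {x | 𝓕 (G : ℝ → ℂ) x = 0} := isClosed_eq hcont continuous_const
  exact hclosed.mem_of_frequently_of_tendsto hfreq tendsto_id

theorem IsBandlimited.integrable_fourier {τ : ℝ} {G : ℝ → ℂ} (hG : IsBandlimited τ G) :
    Integrable (𝓕 G) := by
  refine (continuous_fourier_of_integrable hG.1).integrable_of_hasCompactSupport ?_
  refine HasCompactSupport.intro (isCompact_closedBall (0 : ℝ) τ) fun t ht => hG.2 t ?_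
  simpa using ht

/-- `G` need not be continuous, so inversion is tested against smooth compactly supported functions,
where it reduces to inversion for Schwartz functions. -/
theorem ae_eq_fourierInv_fourier {G : ℝ → ℂ} (hG : Integrable G) (hG' : Integrable (𝓕 G)) :
    G =ᵐ[volume] 𝓕⁻ (𝓕 G) := by
  have hcont : Continuous (𝓕⁻ (𝓕 G)) := by
    rw [Real.fourierInv_eq_fourier_comp_neg]
    exact continuous_fourier_of_integrable hG'.comp_neg
  refine ae_eq_of_integral_contDiff_smul_eq hG.locallyIntegrable hcont.locallyIntegrable
    fun g g_smooth g_cpt => ?_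
  have hg₁ : HasCompactSupport (Complex.ofRealCLM ∘ g) := g_cpt.comp_left rfl
  have hg₂ : ContDiff ℝ (⊤ : ℕ∞) (Complex.ofRealCLM ∘ g) := by fun_prop
  set φ : 𝓢(ℝ, ℂ) := hg₁.toSchwartzMap hg₂
  set ψ : 𝓢(ℝ, ℂ) := 𝓕⁻ φ
  have hψ : 𝓕 (ψ : ℝ → ℂ) = φ := by
    rw [← SchwartzMap.fourier_coe, FourierTransform.fourier_fourierInv_eq]
  calc ∫ x, g x • G x = ∫ x, G x * 𝓕 (ψ : ℝ → ℂ) x := by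
        rw [hψ]; congr with x; simp [φ, mul_comm]
    _ = ∫ t, 𝓕 G t * ψ t :=
        (integral_fourier_mul_eq_integral_mul_fourier hG ψ.integrable).symm
    _ = ∫ t, 𝓕 G (-t) * 𝓕 (φ : ℝ → ℂ) t := by
        rw [← integral_neg_eq_self]
        congr with t
        rw [SchwartzMap.fourierInv_coe, Real.fourierInv_eq_fourier_neg, neg_neg]
    _ = ∫ x, 𝓕 (fun t => 𝓕 G (-t)) x * φ x :=
        (integral_fourier_mul_eq_integral_mul_fourier hG'.comp_neg φ.integrable).symm
    _ = ∫ x, g x • 𝓕⁻ (𝓕 G) x := by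
        rw [Real.fourierInv_eq_fourier_comp_neg]
        congr with x
        simp [φ, mul_comm]

/-! ### The de la Vallée-Poussin kernel and its reproducing property -/

/-- The Fourier transform of the indicator function of `[-b, b]`. -/
theorem fourier_indicator_Icc (b : ℝ) (hb : 0 < b) (w : ℝ) :
    𝓕 ((Set.Icc (-b) b).indicator (fun _ => (1 : ℂ))) w
      = ((2 * b * Real.sinc (2 * Real.pi * b * w) : ℝ) : ℂ) := by
  have h1 : 𝓕 ((Set.Icc (-b) b).indicator (fun _ => (1 : ℂ))) w
      = ∫ v in (-b)..b, Complex.exp ((-(2 * Real.pi * w) * Complex.I) * v) := by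
    rw [Real.fourier_real_eq_integral_exp_smul, intervalIntegral.integral_of_le (by linarith),
      ← integral_Icc_eq_integral_Ioc, ← integral_indicator measurableSet_Icc]
    congr with v
    by_cases hv : v ∈ Set.Icc (-b) b
    · simp only [hv, Set.indicator_of_mem, smul_eq_mul, mul_one]
      congr 1
      push_cast
      ring
    · simp [hv]
  rw [h1]
  rcases eq_or_ne w 0 with rfl | hw
  · simp
    ring
  · have hpi := Real.pi_pos.ne'
    have hwc : (w : ℂ) ≠ 0 := by exact_mod_cast hw
    have hpc : (Real.pi : ℂ) ≠ 0 := by exact_mod_cast hpi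
    have hbc : (b : ℂ) ≠ 0 := by exact_mod_cast hb.ne'
    have hc : (-(2 * Real.pi * w) * Complex.I : ℂ) ≠ 0 := by
      simp [hwc, hpc]
    rw [integral_exp_mul_complex hc, Real.sinc_of_ne_zero (by positivity)]
    push_cast
    rw [Complex.sin]
    field_simp
    ring_nf
    simp only [Complex.I_sq]
    ring

/-- The de la Vallée-Poussin kernel, whose Fourier transform is the trapezoid which is `1` on
`[-(c - b), c - b]` and vanishes outside `[-(c + b), c + b]`. -/
def valleePoussinKernel (b c u : ℝ) : ℝ :=
  2 * c * Real.sinc (2 * Real.pi * b * u) * Real.sinc (2 * Real.pi * c * u)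

theorem valleePoussinKernel_neg (b c u : ℝ) :
    valleePoussinKernel b c (-u) = valleePoussinKernel b c u := by
  simp [valleePoussinKernel]

theorem continuous_valleePoussinKernel (b c : ℝ) : Continuous (valleePoussinKernel b c) := by
  have h := Real.continuous_sinc
  unfold valleePoussinKernel
  fun_prop

theorem abs_valleePoussinKernel_le {b c : ℝ} (hc : 0 ≤ c) (u : ℝ) :
    |valleePoussinKernel b c u| ≤ 2 * c := by
  rw [valleePoussinKernel, abs_mul, abs_mul, abs_of_nonneg (by positivity : 0 ≤ 2 * c)]
  have h1 := Real.abs_sinc_le_one (2 * Real.pi * b * u)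
  have h2 := Real.abs_sinc_le_one (2 * Real.pi * c * u)
  calc 2 * c * _ * _ ≤ 2 * c * 1 * 1 := by gcongr
    _ = 2 * c := by ring

theorem abs_valleePoussinKernel_le_sin {b c u : ℝ} (hb : 0 < b) (hc : 0 < c) (hu : u ≠ 0) :
    |valleePoussinKernel b c u|
      ≤ |Real.sin (2 * Real.pi * b * u)| * (2 * Real.pi ^ 2 * b)⁻¹ * (u ^ 2)⁻¹ := by
  have hpi := Real.pi_pos
  have h1 := Real.abs_sin_le_one (2 * Real.pi * c * u)
  have hK : valleePoussinKernel b c u = Real.sin (2 * Real.pi * b * u) *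
      Real.sin (2 * Real.pi * c * u) * (2 * Real.pi ^ 2 * b)⁻¹ * (u ^ 2)⁻¹ := by
    rw [valleePoussinKernel, Real.sinc_of_ne_zero (by positivity),
      Real.sinc_of_ne_zero (by positivity)]
    field_simp
  have h2 : 0 ≤ (2 * Real.pi ^ 2 * b)⁻¹ := by positivity
  have h3 : 0 ≤ (u ^ 2)⁻¹ := by positivity
  rw [hK, abs_mul, abs_mul, abs_mul, abs_of_nonneg h2, abs_of_nonneg h3]
  calc _ ≤ |Real.sin (2 * Real.pi * b * u)| * 1 * (2 * Real.pi ^ 2 * b)⁻¹ * (u ^ 2)⁻¹ := by gcongr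
    _ = _ := by ring

theorem integrable_indicator_Icc_one (b : ℝ) :
    Integrable ((Set.Icc (-b) b).indicator (fun _ => (1 : ℂ))) :=
  (integrable_indicator_iff measurableSet_Icc).2 (integrableOn_const (by simp))

open Convolution in
/-- The trapezoid function, as a convolution of two indicator functions. -/
theorem indicator_convolution_indicator_apply {b c t : ℝ} (hb : 0 < b) (ht : |t| ≤ c - b) :
    ((Set.Icc (-b) b).indicator (fun _ => (1 : ℂ)) ⋆[ContinuousLinearMap.mul ℂ ℂ]
      (Set.Icc (-c) c).indicator (fun _ => (1 : ℂ))) t = 2 * b := by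
  rw [convolution_def]
  calc _ = ∫ s, (Set.Icc (-b) b).indicator (fun _ => (1 : ℂ)) s := by
        congr with s
        by_cases hs : s ∈ Set.Icc (-b) b
        · have : t - s ∈ Set.Icc (-c) c := by
            rw [abs_le] at ht
            constructor <;> linarith [hs.1, hs.2, ht.1, ht.2]
          simp [hs, this]
        · simp [hs]
    _ = 2 * b := by
        rw [integral_indicator measurableSet_Icc]
        simp [measureReal_def, ENNReal.toReal_ofReal (by linarith : 0 ≤ b + b)]
        ring

open Convolution in
/-- Functions with frequencies in `[-(c - b), c - b]` are reproduced by the de la Vallée-Poussin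
kernel. -/
theorem IsBandlimited.ae_eq_integral_valleePoussinKernel {b c : ℝ} (hb : 0 < b) (hc : 0 < c)
    {G : ℝ → ℂ} (hG : IsBandlimited (c - b) G) :
    ∀ᵐ x, G x = ∫ y, G y * (valleePoussinKernel b c (x - y) : ℂ) := by
  filter_upwards [ae_eq_fourierInv_fourier hG.1 hG.integrable_fourier] with x hx
  have hbc : (b : ℂ) ≠ 0 := by exact_mod_cast hb.ne'
  set T : ℝ → ℂ := (Set.Icc (-b) b).indicator (fun _ => (1 : ℂ)) ⋆[ContinuousLinearMap.mul ℂ ℂ]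
      (Set.Icc (-c) c).indicator (fun _ => (1 : ℂ)) with hT
  have hTint : Integrable T :=
    (integrable_indicator_Icc_one b).integrable_convolution _ (integrable_indicator_Icc_one c)
  have hTF : ∀ w, 𝓕 T w = 2 * b * (valleePoussinKernel b c w : ℂ) := by
    intro w
    rw [hT, Real.fourier_mul_convolution_eq (integrable_indicator_Icc_one b)
      (integrable_indicator_Icc_one c), fourier_indicator_Icc b hb, fourier_indicator_Icc c hc,
      valleePoussinKernel]
    push_cast
    ring
  -- The trapezoid, normalized to height `1` and modulated so that its transform is `y ↦ K(x - y)`.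
  -- On the band it equals the character of Fourier inversion at `x`.
  set h : ℝ → ℂ := fun t => Real.fourierChar (t * x) • ((2 * b : ℂ)⁻¹ * T t) with hh
  have hhint : Integrable h := by
    have := (Real.fourierIntegral_convergent_iff (μ := volume) (-x)).2
      (hTint.const_mul (2 * b : ℂ)⁻¹)
    simpa [hh, mul_comm] using this
  have hhF : ∀ y, 𝓕 h y = (valleePoussinKernel b c (x - y) : ℂ) := by
    intro y
    have : 𝓕 h y = (2 * b : ℂ)⁻¹ * 𝓕 T (y - x) := by
      rw [Real.fourier_real_eq, Real.fourier_real_eq, ← integral_const_mul]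
      congr with t
      simp only [hh, Circle.smul_def, smul_eq_mul]
      rw [show -(t * (y - x)) = -(t * y) + t * x by ring, AddChar.map_add_eq_mul]
      push_cast
      ring
    rw [this, hTF, ← valleePoussinKernel_neg, neg_sub]
    field_simp
  calc G x = 𝓕⁻ (𝓕 G) x := hx
    _ = ∫ t, 𝓕 G t * h t := by
        rw [Real.fourierInv_eq]
        congr with t
        by_cases ht : c - b < |t|
        · simp [hG.2 t ht]
        · simp only [hh, hT]
          rw [indicator_convolution_indicator_apply hb (not_lt.1 ht)]
          simp only [Circle.smul_def, smul_eq_mul]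
          rw [inv_mul_cancel₀ (by simpa using hb.ne'), mul_one, mul_comm]
          simp [mul_comm]
    _ = ∫ y, G y * 𝓕 h y := integral_fourier_mul_eq_integral_mul_fourier hG.1 hhint
    _ = _ := by simp_rw [hhF]

/-! ### Tail estimates for the kernel -/

theorem lintegral_Ioi_inv_sq {r : ℝ} (hr : 0 < r) :
    ∫⁻ x in Set.Ioi r, ENNReal.ofReal ((x ^ 2)⁻¹) = ENNReal.ofReal r⁻¹ := by
  have hcongr : Set.EqOn (fun x : ℝ => x ^ (-2 : ℝ)) (fun x => (x ^ 2)⁻¹) (Set.Ioi r) := by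
    intro x hx
    have : 0 ≤ x := hr.le.trans (le_of_lt hx)
    simp only
    rw [Real.rpow_neg this]
    norm_num
  have hint : IntegrableOn (fun x : ℝ => (x ^ 2)⁻¹) (Set.Ioi r) :=
    (integrableOn_Ioi_rpow_of_lt (by norm_num : (-2 : ℝ) < -1) hr).congr_fun hcongr
      measurableSet_Ioi
  rw [← ofReal_integral_eq_lintegral_ofReal hint (ae_of_all _ fun x => by positivity),
    ← setIntegral_congr_fun measurableSet_Ioi hcongr,
    integral_Ioi_rpow_of_lt (by norm_num : (-2 : ℝ) < -1) hr]
  congr 1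
  norm_num
  rw [Real.rpow_neg_one]

theorem lintegral_abs_gt_of_even {f : ℝ → ℝ≥0∞} (hf : ∀ x, f (-x) = f x) (r : ℝ) :
    ∫⁻ x in {x | r < |x|}, f x ≤ 2 * ∫⁻ x in Set.Ioi r, f x := by
  have hsub : {x : ℝ | r < |x|} ⊆ Set.Ioi r ∪ Set.Iio (-r) := by
    intro x hx
    have hx' : r < |x| := hx
    rcases lt_abs.1 hx' with h | h
    · exact Or.inl h
    · exact Or.inr (by simpa using by linarith)
  have hneg : ∫⁻ x in Set.Iio (-r), f x = ∫⁻ x in Set.Ioi r, f x := by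
    have h := (Measure.measurePreserving_neg (volume : Measure ℝ)).setLIntegral_comp_preimage_emb
      (MeasurableEquiv.neg ℝ).measurableEmbedding f (Set.Ioi r)
    have hpre : (Neg.neg : ℝ → ℝ) ⁻¹' Set.Ioi r = Set.Iio (-r) := by
      ext x; simp
    rw [← h, hpre]
    simp_rw [hf]
  calc _ ≤ ∫⁻ x in Set.Ioi r ∪ Set.Iio (-r), f x := lintegral_mono_set hsub
    _ ≤ _ := lintegral_union_le _ _ _
    _ = _ := by rw [hneg, two_mul]

theorem lintegral_valleePoussinKernel_tail_le {b c r : ℝ} (hb : 0 < b) (hc : 0 < c) (hr : 0 < r) :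
    ∫⁻ x in {x | r < |x|}, ‖valleePoussinKernel b c x‖ₑ
      ≤ ENNReal.ofReal ((Real.pi ^ 2 * b * r)⁻¹) := by
  have hpi := Real.pi_pos
  calc _ ≤ 2 * ∫⁻ x in Set.Ioi r, ‖valleePoussinKernel b c x‖ₑ :=
        lintegral_abs_gt_of_even (fun x => by rw [valleePoussinKernel_neg]) r
    _ ≤ 2 * ∫⁻ x in Set.Ioi r,
          ENNReal.ofReal ((2 * Real.pi ^ 2 * b)⁻¹) * ENNReal.ofReal ((x ^ 2)⁻¹) := by
        gcongr 2 * ?_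
        refine setLIntegral_mono' measurableSet_Ioi fun x hx => ?_
        rw [Real.enorm_eq_ofReal_abs, ← ENNReal.ofReal_mul (by positivity)]
        refine ENNReal.ofReal_le_ofReal
          ((abs_valleePoussinKernel_le_sin hb hc (hr.trans hx).ne').trans ?_)
        have := Real.abs_sin_le_one (2 * Real.pi * b * x)
        calc _ ≤ 1 * (2 * Real.pi ^ 2 * b)⁻¹ * (x ^ 2)⁻¹ := by gcongr
          _ = _ := by ring
    _ = _ := by
        rw [lintegral_const_mul' _ _ ENNReal.ofReal_ne_top, lintegral_Ioi_inv_sq hr,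
          ← ENNReal.ofReal_mul (by positivity), ← ENNReal.ofReal_ofNat,
          ← ENNReal.ofReal_mul (by positivity)]
        congr 1
        field_simp

/-- Bounding both sines by `1` gives only `2/π²`, slightly above `1/5`. With `b = 1/(2r)` the sine
retained in `abs_valleePoussinKernel_le_sin` vanishes at `x = r`, so it is at most `1/2` up to
`11r/10`; this saving lowers the bound to `21/(11π²)`. -/
theorem lintegral_valleePoussinKernel_tail_le_fifth {c r : ℝ} (hc : 0 < c) (hr : 0 < r) :
    ∫⁻ x in {x | r < |x|}, ‖valleePoussinKernel (2 * r)⁻¹ c x‖ₑ ≤ ENNReal.ofReal (1 / 5) := by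
  have hpi := Real.pi_pos
  have hb : 0 < (2 * r)⁻¹ := by positivity
  have hsin : ∀ x, r < x → x ≤ 11 / 10 * r → |Real.sin (2 * Real.pi * (2 * r)⁻¹ * x)| ≤ 1 / 2 := by
    intro x hx hx'
    have h1 : 2 * Real.pi * (2 * r)⁻¹ * x = Real.pi * ((x - r) / r) + Real.pi := by
      field_simp
      ring
    have h2 : 0 ≤ (x - r) / r := by
      have : 0 ≤ x - r := by linarith
      positivity
    have h3 : (x - r) / r ≤ 1 / 10 := by
      rw [div_le_iff₀ hr]; linarith
    rw [h1, Real.sin_add_pi, abs_neg]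
    calc _ ≤ |Real.pi * ((x - r) / r)| := Real.abs_sin_le_abs
      _ = Real.pi * ((x - r) / r) := abs_of_nonneg (by positivity)
      _ ≤ 3.15 * (1 / 10) := by gcongr; exact Real.pi_lt_d2.le
      _ ≤ 1 / 2 := by norm_num
  -- Half the coefficient of `x⁻²`: one copy suffices up to `11r/10`, two are needed beyond.
  set A : ℝ := (Real.pi ^ 2 * (2 * r)⁻¹ * 4)⁻¹ with hA
  have hA0 : 0 ≤ A := by positivity
  calc _ ≤ 2 * ∫⁻ x in Set.Ioi r, ‖valleePoussinKernel (2 * r)⁻¹ c x‖ₑ :=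
        lintegral_abs_gt_of_even (fun x => by rw [valleePoussinKernel_neg]) r
    _ ≤ 2 * ∫⁻ x in Set.Ioi r, (ENNReal.ofReal A * ENNReal.ofReal ((x ^ 2)⁻¹) +
          (Set.Ioi (11 / 10 * r)).indicator
            (fun x => ENNReal.ofReal A * ENNReal.ofReal ((x ^ 2)⁻¹)) x) := by
        gcongr 2 * ?_
        refine setLIntegral_mono' measurableSet_Ioi fun x hx => ?_
        have hK := abs_valleePoussinKernel_le_sin (c := c) hb hc (hr.trans hx).ne'
        rw [Real.enorm_eq_ofReal_abs, ← ENNReal.ofReal_mul hA0]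
        by_cases hx' : x ≤ 11 / 10 * r
        · refine le_add_right (ENNReal.ofReal_le_ofReal (hK.trans ?_))
          calc _ ≤ 1 / 2 * (2 * Real.pi ^ 2 * (2 * r)⁻¹)⁻¹ * (x ^ 2)⁻¹ := by
                gcongr; exact hsin x hx hx'
            _ = _ := by rw [hA]; field_simp; norm_num
        · have hmem : x ∈ Set.Ioi (11 / 10 * r) := not_le.1 hx'
          rw [Set.indicator_of_mem hmem, ← ENNReal.ofReal_mul hA0,
            ← ENNReal.ofReal_add (by positivity) (by positivity)]
          refine ENNReal.ofReal_le_ofReal (hK.trans ?_)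
          have := Real.abs_sin_le_one (2 * Real.pi * (2 * r)⁻¹ * x)
          calc _ ≤ 1 * (2 * Real.pi ^ 2 * (2 * r)⁻¹)⁻¹ * (x ^ 2)⁻¹ := by gcongr
            _ = _ := by rw [hA]; field_simp; norm_num
    _ ≤ 2 * (ENNReal.ofReal A * ENNReal.ofReal r⁻¹ +
          ENNReal.ofReal A * ENNReal.ofReal (11 / 10 * r)⁻¹) := by
        gcongr 2 * ?_
        rw [lintegral_add_left (by fun_prop), lintegral_const_mul' _ _ ENNReal.ofReal_ne_top,
          lintegral_Ioi_inv_sq hr]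
        gcongr
        rw [← lintegral_Ioi_inv_sq (by positivity : 0 < 11 / 10 * r),
          ← lintegral_const_mul' _ _ ENNReal.ofReal_ne_top,
          ← lintegral_indicator (μ := volume) (s := Set.Ioi (11 / 10 * r)) measurableSet_Ioi]
        exact setLIntegral_le_lintegral _ _
    _ = ENNReal.ofReal (2 * (A * r⁻¹ + A * (11 / 10 * r)⁻¹)) := by
        rw [← ENNReal.ofReal_mul hA0, ← ENNReal.ofReal_mul hA0,
          ← ENNReal.ofReal_add (by positivity) (by positivity), ← ENNReal.ofReal_ofNat,
          ← ENNReal.ofReal_mul (by positivity)]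
    _ ≤ _ := by
        refine ENNReal.ofReal_le_ofReal ?_
        have : 2 * (A * r⁻¹ + A * (11 / 10 * r)⁻¹) = 21 / 11 / Real.pi ^ 2 := by
          rw [hA]; field_simp; norm_num
        rw [this, div_le_iff₀ (by positivity)]
        nlinarith [Real.pi_gt_d2]

/-! ### Splitting the kernel and iterating -/

open Convolution in
-- Tonelli. The near part uses it with `μ` the restriction to `N`, the tail with Lebesgue measure.
theorem lintegral_enorm_convolution_le {μ : Measure ℝ} [SFinite μ] {G f : ℝ → ℂ}
    (hG : Integrable G) (hf : Measurable f) {B : ℝ≥0∞}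
    (hB : ∀ y, ∫⁻ x, ‖f (x - y)‖ₑ ∂μ ≤ B) :
    ∫⁻ x, ‖(G ⋆[ContinuousLinearMap.mul ℂ ℂ] f) x‖ₑ ∂μ ≤ B * ∫⁻ y, ‖G y‖ₑ := by
  have hGm : AEMeasurable (fun y => ‖G y‖ₑ) := hG.aestronglyMeasurable.enorm
  calc _ ≤ ∫⁻ x, ∫⁻ y, ‖G y‖ₑ * ‖f (x - y)‖ₑ ∂volume ∂μ := by
        refine lintegral_mono fun x => ?_
        rw [convolution_def]
        refine (enorm_integral_le_lintegral_enorm _).trans_eq ?_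
        simp
    _ = ∫⁻ y, ∫⁻ x, ‖G y‖ₑ * ‖f (x - y)‖ₑ ∂μ := by
        refine lintegral_lintegral_swap ?_
        refine (hGm.comp_quasiMeasurePreserving Measure.quasiMeasurePreserving_snd).mul ?_
        exact (hf.comp (measurable_fst.sub measurable_snd)).enorm.aemeasurable
    _ ≤ ∫⁻ y, ‖G y‖ₑ * B := by
        refine lintegral_mono fun y => ?_
        have hfy : Measurable fun x => ‖f (x - y)‖ₑ := (hf.comp (measurable_id.sub_const y)).enorm
        rw [lintegral_const_mul _ hfy]
        gcongr
        exact hB y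
    _ = _ := by rw [lintegral_mul_const'' _ hGm, mul_comm]

open Convolution in
theorem IsBandlimited.convolution {τ : ℝ} {G f : ℝ → ℂ} (hG : IsBandlimited τ G)
    (hf : Integrable f) : IsBandlimited τ (G ⋆[ContinuousLinearMap.mul ℂ ℂ] f) := by
  refine ⟨hG.1.integrable_convolution _ hf, fun t ht => ?_⟩
  rw [Real.fourier_mul_convolution_eq hG.1 hf, hG.2 t ht, zero_mul]

/-- The part of the de la Vallée-Poussin kernel away from the origin. -/
def valleePoussinTail (b c r : ℝ) : ℝ → ℂ :=
  {u : ℝ | r < |u|}.indicator fun u => (valleePoussinKernel b c u : ℂ)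

theorem measurableSet_lt_abs (r : ℝ) : MeasurableSet {u : ℝ | r < |u|} :=
  measurableSet_lt measurable_const measurable_id.abs

theorem measurable_valleePoussinKernel (b c : ℝ) :
    Measurable fun u => (valleePoussinKernel b c u : ℂ) :=
  Complex.measurable_ofReal.comp (continuous_valleePoussinKernel b c).measurable

theorem measurable_valleePoussinTail (b c r : ℝ) : Measurable (valleePoussinTail b c r) :=
  (measurable_valleePoussinKernel b c).indicator (measurableSet_lt_abs r)

theorem lintegral_valleePoussinTail (b c r : ℝ) :
    ∫⁻ u, ‖valleePoussinTail b c r u‖ₑ = ∫⁻ u in {u | r < |u|}, ‖valleePoussinKernel b c u‖ₑ := by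
  rw [← lintegral_indicator (measurableSet_lt_abs r)]
  congr with u
  rw [valleePoussinTail, enorm_indicator_eq_indicator_enorm]
  by_cases hu : u ∈ {u : ℝ | r < |u|}
  · rw [Set.indicator_of_mem hu, Set.indicator_of_mem hu, ← ofReal_norm, ← ofReal_norm]
    simp
  · rw [Set.indicator_of_notMem hu, Set.indicator_of_notMem hu]

theorem norm_valleePoussinKernel_le {b c : ℝ} (hc : 0 ≤ c) (u : ℝ) :
    ‖(valleePoussinKernel b c u : ℂ)‖ ≤ 2 * c := by
  rw [Complex.norm_real]
  exact abs_valleePoussinKernel_le hc u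

open Convolution in
/-- Splitting the reproducing kernel at distance `r` from the origin. -/
theorem IsBandlimited.setLIntegral_le_add {b c r : ℝ} (hb : 0 < b) (hc : 0 < c)
    {G : ℝ → ℂ} (hG : IsBandlimited (c - b) G) (N : Set ℝ) :
    ∫⁻ x in N, ‖G x‖ₑ ≤ ENNReal.ofReal (2 * c) *
        (⨆ x : ℝ, volume (N ∩ Set.Icc x (x + 2 * r))) * (∫⁻ x, ‖G x‖ₑ) +
      ∫⁻ x in N, ‖(G ⋆[ContinuousLinearMap.mul ℂ ℂ] valleePoussinTail b c r) x‖ₑ := by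
  set g : ℝ → ℂ := {u : ℝ | r < |u|}ᶜ.indicator fun u => (valleePoussinKernel b c u : ℂ) with hg
  have hgm : Measurable g :=
    (measurable_valleePoussinKernel b c).indicator (measurableSet_lt_abs r).compl
  have hsplit : ∀ u, (valleePoussinKernel b c u : ℂ) = g u + valleePoussinTail b c r u := by
    intro u
    exact (Set.indicator_compl_add_self_apply {u : ℝ | r < |u|}
      (fun u => (valleePoussinKernel b c u : ℂ)) u).symm
  have hgb : ∀ u, ‖g u‖ ≤ 2 * c := fun u =>
    (norm_indicator_le_norm_self _ _).trans (norm_valleePoussinKernel_le hc.le u)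
  have htb : ∀ u, ‖valleePoussinTail b c r u‖ ≤ 2 * c := fun u =>
    (norm_indicator_le_norm_self _ _).trans (norm_valleePoussinKernel_le hc.le u)
  have hint : ∀ f : ℝ → ℂ, Measurable f → (∀ u, ‖f u‖ ≤ 2 * c) → ∀ x,
      Integrable fun y => G y * f (x - y) := fun f hf hfb x =>
    hG.1.mul_bdd (hf.comp (measurable_const.sub measurable_id)).aestronglyMeasurable
      (ae_of_all _ fun y => hfb _)
  have hmain : ∀ᵐ x, ‖G x‖ₑ ≤ ‖(G ⋆[ContinuousLinearMap.mul ℂ ℂ] g) x‖ₑ +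
      ‖(G ⋆[ContinuousLinearMap.mul ℂ ℂ] valleePoussinTail b c r) x‖ₑ := by
    filter_upwards [hG.ae_eq_integral_valleePoussinKernel hb hc] with x hx
    have : G x = (G ⋆[ContinuousLinearMap.mul ℂ ℂ] g) x +
        (G ⋆[ContinuousLinearMap.mul ℂ ℂ] valleePoussinTail b c r) x := by
      rw [hx, convolution_def, convolution_def]
      simp only [ContinuousLinearMap.mul_apply']
      rw [← integral_add (hint g hgm hgb x)
        (hint _ (measurable_valleePoussinTail b c r) htb x)]
      simp_rw [hsplit, mul_add]
    rw [this]
    exact enorm_add_le _ _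
  have hgN : ∀ y, ∫⁻ x in N, ‖g (x - y)‖ₑ ≤ ENNReal.ofReal (2 * c) *
      (⨆ x : ℝ, volume (N ∩ Set.Icc x (x + 2 * r))) := by
    intro y
    calc _ ≤ ∫⁻ x in N, (Set.Icc (y - r) (y - r + 2 * r)).indicator
            (fun _ => ENNReal.ofReal (2 * c)) x := by
          refine lintegral_mono fun x => ?_
          by_cases hx : x ∈ Set.Icc (y - r) (y - r + 2 * r)
          · simp only [hx, Set.indicator_of_mem]
            rw [← ofReal_norm]
            exact ENNReal.ofReal_le_ofReal (hgb _)
          · have : x - y ∉ {u : ℝ | r < |u|}ᶜ := by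
              intro h
              have h' : |x - y| ≤ r := not_lt.1 h
              rw [abs_le] at h'
              exact hx ⟨by linarith [h'.1], by linarith [h'.2]⟩
            simp [hg, Set.indicator_of_notMem this]
      _ = ENNReal.ofReal (2 * c) * volume (N ∩ Set.Icc (y - r) (y - r + 2 * r)) := by
          rw [lintegral_indicator_const measurableSet_Icc,
            Measure.restrict_apply measurableSet_Icc, Set.inter_comm]
      _ ≤ _ := by
          gcongr
          exact le_iSup (fun x : ℝ => volume (N ∩ Set.Icc x (x + 2 * r))) (y - r)
  have hconvm : AEMeasurable (fun x => ‖(G ⋆[ContinuousLinearMap.mul ℂ ℂ] g) x‖ₑ)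
      (volume.restrict N) := by
    have hgi : Integrable g := by
      refine (integrable_indicator_iff (measurableSet_lt_abs r).compl).2 ?_
      refine Measure.integrableOn_of_bounded (M := 2 * c) ?_
        (measurable_valleePoussinKernel b c).aestronglyMeasurable
        (ae_of_all _ fun u => norm_valleePoussinKernel_le hc.le u)
      refine ((measure_mono (t := Set.Icc (-r) r) fun u hu => ?_).trans_lt
        (by simp)).ne
      exact abs_le.1 (not_lt.1 hu)
    exact (hG.1.integrable_convolution _ hgi).aestronglyMeasurable.enorm.restrict
  calc _ ≤ _ := lintegral_mono_ae (ae_restrict_of_ae hmain)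
    _ = _ := lintegral_add_left' hconvm _
    _ ≤ _ := by
        gcongr
        exact lintegral_enorm_convolution_le hG.1 hgm hgN

open Convolution in
/-- The concentration inequality, by iterating `IsBandlimited.setLIntegral_le_add`. -/
theorem IsBandlimited.setLIntegral_le {b c r η : ℝ} (hb : 0 < b) (hc : 0 < c) (hη : 0 ≤ η)
    (hη1 : η < 1)
    (htail : ∫⁻ x in {x | r < |x|}, ‖valleePoussinKernel b c x‖ₑ ≤ ENNReal.ofReal η)
    (N : Set ℝ) {G : ℝ → ℂ} (hG : IsBandlimited (c - b) G) :
    ∫⁻ x in N, ‖G x‖ₑ ≤ ENNReal.ofReal (2 * c / (1 - η)) *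
      (⨆ x : ℝ, volume (N ∩ Set.Icc x (x + 2 * r))) * ∫⁻ x, ‖G x‖ₑ := by
  set S : ℝ≥0∞ := ⨆ x : ℝ, volume (N ∩ Set.Icc x (x + 2 * r))
  have hη1' : 0 < 1 - η := by linarith
  have htail' : ∫⁻ x, ‖valleePoussinTail b c r x‖ₑ ≤ ENNReal.ofReal η := by
    rwa [lintegral_valleePoussinTail]
  have htint : Integrable (valleePoussinTail b c r) :=
    ⟨(measurable_valleePoussinTail b c r).aestronglyMeasurable,
      htail'.trans_lt ENNReal.ofReal_lt_top⟩
  -- Quantified over `G` because the induction hypothesis is applied to `G ⋆ tail`.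
  have hiter : ∀ n : ℕ, ∀ G : ℝ → ℂ, IsBandlimited (c - b) G →
      ∫⁻ x in N, ‖G x‖ₑ ≤
        (ENNReal.ofReal (2 * c / (1 - η)) * S + ENNReal.ofReal η ^ n) * ∫⁻ x, ‖G x‖ₑ := by
    intro n
    induction n with
    | zero =>
      intro G _
      rw [pow_zero]
      calc _ ≤ ∫⁻ x, ‖G x‖ₑ := setLIntegral_le_lintegral _ _
        _ = 1 * ∫⁻ x, ‖G x‖ₑ := (one_mul _).symm
        _ ≤ _ := by gcongr; exact le_add_self
    | succ n ih =>
      intro G hG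
      have hconv : ∫⁻ x, ‖(G ⋆[ContinuousLinearMap.mul ℂ ℂ] valleePoussinTail b c r) x‖ₑ ≤
          ENNReal.ofReal η * ∫⁻ x, ‖G x‖ₑ := by
        refine lintegral_enorm_convolution_le hG.1 (measurable_valleePoussinTail b c r) fun y => ?_
        rwa [lintegral_sub_right_eq_self (fun x => ‖valleePoussinTail b c r x‖ₑ) y]
      -- `2c / (1 - η)` is the fixed point of `a ↦ 2c + η a`.
      have hsum : ENNReal.ofReal (2 * c) + ENNReal.ofReal η * ENNReal.ofReal (2 * c / (1 - η))
          = ENNReal.ofReal (2 * c / (1 - η)) := by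
        rw [← ENNReal.ofReal_mul hη, ← ENNReal.ofReal_add (by positivity) (by positivity)]
        congr 1
        field_simp
        ring
      calc _ ≤ _ := hG.setLIntegral_le_add hb hc N
        _ ≤ ENNReal.ofReal (2 * c) * S * (∫⁻ x, ‖G x‖ₑ) +
            (ENNReal.ofReal (2 * c / (1 - η)) * S + ENNReal.ofReal η ^ n) *
              (ENNReal.ofReal η * ∫⁻ x, ‖G x‖ₑ) := by
            gcongr
            exact (ih _ (hG.convolution htint)).trans (by gcongr)
        _ = ((ENNReal.ofReal (2 * c) + ENNReal.ofReal η * ENNReal.ofReal (2 * c / (1 - η))) * S +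
            ENNReal.ofReal η ^ (n + 1)) * ∫⁻ x, ‖G x‖ₑ := by ring
        _ = _ := by rw [hsum]
  have hfin : ∫⁻ x, ‖G x‖ₑ ≠ ∞ := hG.1.2.ne
  have hlim : Tendsto (fun n : ℕ => (ENNReal.ofReal (2 * c / (1 - η)) * S +
      ENNReal.ofReal η ^ n) * ∫⁻ x, ‖G x‖ₑ) atTop
      (𝓝 ((ENNReal.ofReal (2 * c / (1 - η)) * S + 0) * ∫⁻ x, ‖G x‖ₑ)) :=
    ENNReal.Tendsto.mul_const (tendsto_const_nhds.add
      (ENNReal.tendsto_pow_atTop_nhds_zero_of_lt_one (by simpa using hη1))) (Or.inr hfin)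
  rw [add_zero] at hlim
  exact ge_of_tendsto' hlim fun n => hiter n G hG

/-! ### Choice of the parameters -/

theorem isConcentrationConstant_of_tail_le {τ δ b η : ℝ} (hτ : 0 < τ) (hb : 0 < b)
    (hη : 0 ≤ η) (hη1 : η < 1)
    (htail : ∫⁻ x in {x | δ / 2 < |x|}, ‖valleePoussinKernel b (τ + b) x‖ₑ ≤ ENNReal.ofReal η) :
    IsConcentrationConstant τ δ (2 * (τ + b) / (1 - η)) := by
  intro N hN G hG
  have hG' : IsBandlimited (τ + b - b) G := by
    rw [add_sub_cancel_right]
    exact isBandlimited_of_mem_paleyWienerBall hG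
  have h := hG'.setLIntegral_le hb (by positivity) hη hη1 htail N
  rw [mul_div_cancel₀ δ two_ne_zero] at h
  rw [eLpNorm_one_eq_lintegral_enorm, eLpNorm_one_eq_lintegral_enorm]
  simp_rw [enorm_indicator_eq_indicator_enorm]
  rwa [lintegral_indicator₀ hN]

theorem IsConcentrationConstant.mono {τ δ C C' : ℝ} (h : IsConcentrationConstant τ δ C)
    (hC : C ≤ C') : IsConcentrationConstant τ δ C' := fun N hN G hG =>
  (h N hN G hG).trans (by gcongr)

theorem isConcentrationConstant_five_halves {τ δ : ℝ} (hτ : 0 < τ) (hδ : 0 < δ) :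
    IsConcentrationConstant τ δ (5 / 2 * (τ + δ⁻¹)) := by
  have h := lintegral_valleePoussinKernel_tail_le_fifth (c := τ + δ⁻¹) (r := δ / 2)
    (by positivity) (by positivity)
  rw [mul_div_cancel₀ δ two_ne_zero] at h
  refine (isConcentrationConstant_of_tail_le hτ (inv_pos.2 hδ) (by norm_num) (by norm_num)
    h).mono (le_of_eq ?_)
  ring

theorem isConcentrationConstant_of_one_le_mul {τ δ : ℝ} (hτ : 0 < τ) (hδ : 0 < δ)
    (h1 : 1 ≤ τ * δ) :
    IsConcentrationConstant τ δ ((2 + 4 / √(τ * δ)) * (τ + δ⁻¹)) := by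
  set s := √(τ * δ) with hs
  have hs1 : 1 ≤ s := Real.one_le_sqrt.2 h1
  have hs2 : s ^ 2 = τ * δ := Real.sq_sqrt (by positivity)
  -- With `b = s / (2δ)` the relative excess `b/τ` is `1/(2s)`, and the tail is at most `4/(π² s) ≤
  -- 1/(2s)`.
  have hb : 0 < s / (2 * δ) := by positivity
  have h := lintegral_valleePoussinKernel_tail_le hb (by positivity : 0 < τ + s / (2 * δ))
    (by positivity : 0 < δ / 2)
  have hη : (Real.pi ^ 2 * (s / (2 * δ)) * (δ / 2))⁻¹ ≤ 1 / (2 * s) := by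
    have : Real.pi ^ 2 * (s / (2 * δ)) * (δ / 2) = Real.pi ^ 2 / 4 * s := by
      field_simp
      ring
    rw [this, one_div]
    gcongr
    nlinarith [Real.pi_gt_three]
  have hη1 : 1 / (2 * s) < 1 := by
    rw [div_lt_one (by positivity)]; linarith
  refine (isConcentrationConstant_of_tail_le hτ hb (by positivity) hη1
    (h.trans (ENNReal.ofReal_le_ofReal hη))).mono ?_
  have hτs : τ = s ^ 2 / δ := by rw [hs2]; field_simp
  rw [div_le_iff₀ (by linarith), hτs]
  have key : 2 * s ^ 2 + s ≤ (2 + 4 / s) * (s ^ 2 + 1) * (1 - 1 / (2 * s)) := by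
    have e : (2 + 4 / s) * (s ^ 2 + 1) * (1 - 1 / (2 * s))
        = (2 * s + 4) * (s ^ 2 + 1) * (2 * s - 1) / (2 * s ^ 2) := by field_simp
    rw [e, le_div_iff₀ (by positivity)]
    nlinarith [mul_nonneg (sub_nonneg.2 hs1) (sq_nonneg s),
      mul_nonneg (sub_nonneg.2 hs1) (pow_nonneg (zero_le_one.trans hs1) 3)]
  calc 2 * (s ^ 2 / δ + s / (2 * δ)) = (2 * s ^ 2 + s) * δ⁻¹ := by field_simp
    _ ≤ (2 + 4 / s) * (s ^ 2 + 1) * (1 - 1 / (2 * s)) * δ⁻¹ := by gcongr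
    _ = _ := by ring

end

theorem theorem1 :
    ∃ C : ℝ → ℝ → ℝ,
      (∀ τ δ : ℝ, 0 < τ → 0 < δ → IsConcentrationConstant τ δ (C τ δ)) ∧
      (∀ τ δ : ℝ, 0 < τ → 0 < δ → C τ δ ≤ 80 / 13 * (τ + δ⁻¹)) ∧
      (∀ τ δ : ℝ, 0 < τ → 0 < δ → 2 ≤ τ * δ → C τ δ ≤ 5 / 2 * (τ + δ⁻¹)) ∧
      (∀ ε : ℝ, 0 < ε → ∃ R : ℝ, ∀ τ δ : ℝ, 0 < τ → 0 < δ → R ≤ τ * δ →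
        |C τ δ / (τ + δ⁻¹) - 2| < ε) := by
  -- When the second term attains the minimum, `√(τδ) ≥ 8`, so the bound for `τδ ≥ 1` applies. The
  -- threshold `(8/ε)²` makes `4/√(τδ) ≤ ε/2`.
  refine ⟨fun τ δ => min (5 / 2) (2 + 4 / √(τ * δ)) * (τ + δ⁻¹), fun τ δ hτ hδ => ?_,
    fun τ δ hτ hδ => ?_, fun τ δ hτ hδ _ => ?_, fun ε hε => ⟨(8 / ε) ^ 2, fun τ δ hτ hδ hR => ?_⟩⟩
  · rcases le_total (5 / 2) (2 + 4 / √(τ * δ)) with h | h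
    · simp only [min_eq_left h]
      exact isConcentrationConstant_five_halves hτ hδ
    · simp only [min_eq_right h]
      refine isConcentrationConstant_of_one_le_mul hτ hδ ?_
      have hs : 0 < √(τ * δ) := Real.sqrt_pos.2 (by positivity)
      have h4 : 4 / √(τ * δ) ≤ 1 / 2 := by linarith
      rw [div_le_iff₀ hs] at h4
      exact Real.one_le_sqrt.1 (by linarith)
  · have : min (5 / 2) (2 + 4 / √(τ * δ)) ≤ 80 / 13 := (min_le_left _ _).trans (by norm_num)
    exact mul_le_mul_of_nonneg_right this (by positivity)
  · exact mul_le_mul_of_nonneg_right (min_le_left _ _) (by positivity)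
  · have hpos : 0 < τ + δ⁻¹ := by positivity
    have hs : 8 / ε ≤ √(τ * δ) := Real.le_sqrt_of_sq_le hR
    have hs0 : 0 < √(τ * δ) := lt_of_lt_of_le (by positivity) hs
    have hle : 4 / √(τ * δ) < ε := by
      rw [div_le_iff₀ hε] at hs
      rw [div_lt_iff₀ hs0]
      linarith
    have h0 : 0 < 4 / √(τ * δ) := by positivity
    simp only [mul_div_cancel_right₀ _ hpos.ne']
    have h2 : 2 ≤ min (5 / 2) (2 + 4 / √(τ * δ)) := le_min (by norm_num) (by linarith)
    have h3 := min_le_right (5 / 2) (2 + 4 / √(τ * δ))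
    rw [abs_lt]
    constructor <;> linarith
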